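/- Let $q$ be a positive integer (the case $q=0$ with empty tuples is also allowed), and let $A=(a_1,\dots,a_q)$, $B=(b_1,\dots,b_q)$ be real tuples such that $B$ is weakly supermajorized by $A$, that is, $$0<a_1\le a_2\le\cdots\le a_q,\qquad 0<b_1\le b_2\le\cdots\le b_q,\qquad \sum_{i=1}^{k}a_i\le\sum_{i=1}^{k}b_i\quad(k=1,\dots,q).$$ For real $\sigma\ge 0$ let ${}_{q+1}F_q(\sigma,A;B;z)$ denote the analytic continuation to $\mathbb{C}\setminus[1,\infty)$ of the series $$\sum_{n=0}^{\infty}\frac{(\sigma)_n(a_1)_n\cdots(a_q)_n}{(b_1)_n\cdots(b_q)_n\,n!}\,z^n,\qquad |z|<1,$$ where $(a)_0=1$ and $(a)_n=a(a+1)\cdots(a+n-1)$ for $n\ge1$. This series converges for $|z|<1$ and the (unique) analytic continuation exists. Moreover, for each real $x<1$ the values $f(\sigma)={}_{q+1}F_q(\sigma,A;B;x)$, $\sigma\ge0$, are real and positive, and the function $\sigma\mapsto f(\sigma)$ is log-convex on $[0,\infty)$, i.e. $\sigma\mapsto\log f(\sigma)$ is convex on $[0,\infty)$. -/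

import Mathlib

noncomputable section

namespace GenHyp

/-- `B ≺^W A`: both tuples are positive and weakly increasing, and every partial sum of `A` is at
most the corresponding partial sum of `B`. -/
structure WeaklySupermajorizedBy {q : ℕ} (B A : Fin q → ℝ) : Prop where
  pos_left : ∀ i, 0 < B i
  pos_right : ∀ i, 0 < A i
  mono_left : Monotone B
  mono_right : Monotone A
  sum_le : ∀ k : Fin q, ∑ i ∈ Finset.Iic k, A i ≤ ∑ i ∈ Finset.Iic k, B i

/-- The `n`-th Taylor coefficient `(σ)_n (a_1)_n ⋯ (a_q)_n / ((b_1)_n ⋯ (b_q)_n n!)`, where `(a)_n`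
is the rising factorial. -/
def coeff {q : ℕ} (σ : ℝ) (A B : Fin q → ℝ) (n : ℕ) : ℝ :=
  ((ascPochhammer ℝ n).eval σ * ∏ i, (ascPochhammer ℝ n).eval (A i)) /
    ((∏ i, (ascPochhammer ℝ n).eval (B i)) * (n.factorial : ℝ))

/-- The complex plane cut along the ray `[1, ∞)`. -/
def cutPlane : Set ℂ := {z | z.re < 1 ∨ z.im ≠ 0}

/-- `F` is holomorphic on the cut plane, and in the open unit disk it is the sum of the
(convergent) hypergeometric series. -/
structure IsExtension {q : ℕ} (σ : ℝ) (A B : Fin q → ℝ) (F : ℂ → ℂ) : Prop where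
  differentiableOn : DifferentiableOn ℂ F cutPlane
  hasSum : ∀ z : ℂ, ‖z‖ < 1 → HasSum (fun n : ℕ => (coeff σ A B n : ℂ) * z ^ n) (F z)

open Classical in
/-- The generalized hypergeometric function `_{q+1}F_q(σ, A; B; z)` on the cut plane: the analytic
continuation of the hypergeometric series (it is unique on the cut plane, see
`IsExtension.eqOn`). -/
def hyp {q : ℕ} (σ : ℝ) (A B : Fin q → ℝ) : ℂ → ℂ :=
  if h : ∃ F : ℂ → ℂ, IsExtension σ A B F then h.choose else 0

/-- `f` is log-convex on `s`: it is positive there and its logarithm is convex. -/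
def LogConvexOn (s : Set ℝ) (f : ℝ → ℝ) : Prop :=
  (∀ t ∈ s, 0 < f t) ∧ ConvexOn ℝ s (fun t => Real.log (f t))

theorem isOpen_cutPlane : IsOpen cutPlane :=
  (isOpen_lt Complex.continuous_re continuous_const).union
    (isOpen_ne_fun Complex.continuous_im continuous_const)

theorem isPreconnected_cutPlane : IsPreconnected cutPlane := by
  have hstar : StarConvex ℝ (0 : ℂ) cutPlane := by
    rw [starConvex_zero_iff]
    intro z hz a ha0 ha1
    change z.re < 1 ∨ z.im ≠ 0 at hz
    change (a • z).re < 1 ∨ (a • z).im ≠ 0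
    simp only [Complex.real_smul, Complex.mul_re, Complex.mul_im,
      Complex.ofReal_re, Complex.ofReal_im, zero_mul, sub_zero, add_zero]
    rcases hz with hz | hz
    · left
      rcases le_total z.re 0 with h | h
      · linarith [mul_nonpos_of_nonneg_of_nonpos ha0 h]
      · linarith [mul_le_of_le_one_left h ha1]
    · rcases ha0.eq_or_lt with rfl | ha0
      · left
        simp
      · right
        exact mul_ne_zero ha0.ne' hz
  have h0 : (0 : ℂ) ∈ cutPlane := by simp [cutPlane]
  exact (hstar.isPathConnected h0).isConnected.isPreconnected

/-- Two analytic continuations of the hypergeometric series agree on the cut plane. -/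
theorem IsExtension.eqOn {q : ℕ} {σ : ℝ} {A B : Fin q → ℝ} {F G : ℂ → ℂ}
    (hF : IsExtension σ A B F) (hG : IsExtension σ A B G) : Set.EqOn F G cutPlane := by
  have h0 : (0 : ℂ) ∈ cutPlane := by simp [cutPlane]
  refine (hF.differentiableOn.analyticOnNhd isOpen_cutPlane).eqOn_of_preconnected_of_eventuallyEq
    (hG.differentiableOn.analyticOnNhd isOpen_cutPlane) isPreconnected_cutPlane h0 ?_
  filter_upwards [Metric.ball_mem_nhds (0 : ℂ) one_pos] with z hz
  have hz' : ‖z‖ < 1 := by simpa using hz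
  exact (hF.hasSum z hz').unique (hG.hasSum z hz')

/-- `hyp` is an analytic continuation of the series as soon as there is one. -/
theorem isExtension_hyp {q : ℕ} {σ : ℝ} {A B : Fin q → ℝ} {F : ℂ → ℂ}
    (hF : IsExtension σ A B F) : IsExtension σ A B (hyp σ A B) := by
  have h : ∃ F : ℂ → ℂ, IsExtension σ A B F := ⟨F, hF⟩
  rw [hyp, dif_pos h]
  exact h.choose_spec

end GenHyp

end

/-!
The quotients `(a₁)ₙ ⋯ (a_q)ₙ / ((b₁)ₙ ⋯ (b_q)ₙ)` are the moments of a probability measure `μ` on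
`[0, 1]`. Writing `m_a n = a / (a + n)` for the moments of Beta(`a`, 1), the ratio `(a)ₙ / (b)ₙ` is
the limit of `∏_{k < K} m_{a+k} n / m_{b+k} n` as `K → ∞`, and moment sequences are closed under
products and limits, so it suffices to treat `∏ᵢ m_{aᵢ} / ∏ᵢ m_{bᵢ}`. Majorization breaks this
product into factors `m_a / m_b` with `a ≤ b` and `m_x m_y / (m_z m_w)` with `x ≤ z ≤ y` and
`x + y = z + w`; each is a convex combination of the constant sequence `1` and a moment sequence.

Hence `∫ (1 - t z)^(-σ) dμ(t)` is the analytic continuation of the series, and its value at a real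
`x < 1` is the moment generating function at `σ` of the random variable `-log (1 - t x)`. Moment
generating functions are log-convex by Hölder's inequality.
-/

namespace GenHyp

open Filter Finset MeasureTheory ProbabilityTheory Topology

theorem integrable_of_continuous {X E : Type*} [TopologicalSpace X] [CompactSpace X]
    [MeasurableSpace X] [OpensMeasurableSpace X] [NormedAddCommGroup E]
    [SecondCountableTopologyEither X E] {μ : Measure X} [IsFiniteMeasureOnCompacts μ] {f : X → E}
    (hf : Continuous f) : Integrable f μ :=
  hf.integrable_of_hasCompactSupport (HasCompactSupport.of_compactSpace f)

/-- The Hausdorff moments of a measure on `[0, 1]`. -/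
noncomputable def moments (μ : Measure unitInterval) (n : ℕ) : ℝ :=
  ∫ t : unitInterval, (t : ℝ) ^ n ∂μ

theorem continuous_moments : Continuous fun μ : ProbabilityMeasure unitInterval => moments μ :=
  continuous_pi fun n => ProbabilityMeasure.continuous_integral_boundedContinuousFunction
    (BoundedContinuousFunction.mkOfCompact ⟨fun t : unitInterval => (t : ℝ) ^ n, by fun_prop⟩)

theorem moments_dirac_one : moments (Measure.dirac 1) = 1 := by
  ext n
  simp [moments]

theorem moments_add (μ ν : Measure unitInterval) [IsFiniteMeasure μ] [IsFiniteMeasure ν] :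
    moments (μ + ν) = moments μ + moments ν := by
  ext n
  exact integral_add_measure (integrable_of_continuous (by fun_prop))
    (integrable_of_continuous (by fun_prop))

theorem moments_smul (c : ENNReal) (μ : Measure unitInterval) :
    moments (c • μ) = c.toReal • moments μ := by
  ext n
  exact integral_smul_measure _ c

theorem moments_map {f : unitInterval → unitInterval} (hf : Measurable f)
    (μ : Measure unitInterval) (n : ℕ) :
    moments (μ.map f) n = ∫ t : unitInterval, (f t : ℝ) ^ n ∂μ :=
  integral_map hf.aemeasurable (by fun_prop)

theorem moments_mconv (μ ν : Measure unitInterval) [IsFiniteMeasure μ] [IsFiniteMeasure ν] :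
    moments (μ ∗ₘ ν) = moments μ * moments ν := by
  ext n
  simp only [moments, Pi.mul_apply]
  rw [integral_mconv (integrable_of_continuous (by fun_prop))]
  simp only [Set.Icc.coe_mul, mul_pow, integral_const_mul, integral_mul_const]

/-- The Hausdorff moment sequences, i.e. the sequences `n ↦ 𝔼[Xⁿ]` with `X` a random variable in
`[0, 1]`. They form a submonoid because the product of independent variables has the product of
the moments. -/
def momentSequences : Submonoid (ℕ → ℝ) where
  carrier := Set.range fun μ : ProbabilityMeasure unitInterval => moments μ
  one_mem' := ⟨⟨Measure.dirac 1, inferInstance⟩, moments_dirac_one⟩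
  mul_mem' := by
    rintro _ _ ⟨μ, rfl⟩ ⟨ν, rfl⟩
    exact ⟨⟨μ ∗ₘ ν, inferInstance⟩, moments_mconv μ ν⟩

theorem isClosed_momentSequences : IsClosed (momentSequences : Set (ℕ → ℝ)) :=
  (isCompact_range continuous_moments).isClosed

theorem convex_momentSequences : Convex ℝ (momentSequences : Set (ℕ → ℝ)) := by
  rintro _ ⟨μ, rfl⟩ _ ⟨ν, rfl⟩ a b ha hb hab
  refine ⟨⟨ENNReal.ofReal a • μ + ENNReal.ofReal b • ν, ⟨?_⟩⟩, ?_⟩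
  · simp [← ENNReal.ofReal_add ha hb, hab]
  · have (c : ℝ) (ρ : Measure unitInterval) [IsFiniteMeasure ρ] :
        IsFiniteMeasure (ENNReal.ofReal c • ρ) :=
      ρ.smul_finite ENNReal.ofReal_ne_top
    simp only [ProbabilityMeasure.coe_mk, moments_add, moments_smul, ENNReal.toReal_ofReal ha,
      ENNReal.toReal_ofReal hb]

theorem smul_one_add_smul_mem_momentSequences {m : ℕ → ℝ} (hm : m ∈ momentSequences) {c : ℝ}
    (hc₀ : 0 ≤ c) (hc₁ : c ≤ 1) : c • 1 + (1 - c) • m ∈ momentSequences :=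
  convex_momentSequences momentSequences.one_mem hm hc₀ (sub_nonneg.2 hc₁) (add_sub_cancel c 1)

/-- The moments of the distribution Beta(`a`, 1), which has density `a * t ^ (a - 1)` on `[0, 1]`.
They are the factors into which ratios of Pochhammer symbols decompose. -/
noncomputable def betaMoments (a : ℝ) (n : ℕ) : ℝ :=
  a / (a + n)

theorem betaMoments_pos {a : ℝ} (ha : 0 < a) (n : ℕ) : 0 < betaMoments a n := by
  unfold betaMoments
  positivity

theorem isUnit_betaMoments {a : ℝ} (ha : 0 < a) : IsUnit (betaMoments a) :=
  Pi.isUnit_iff.2 fun n => (betaMoments_pos ha n).ne'.isUnit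

theorem isUnit_prod_betaMoments {ι : Type*} {s : Finset ι} {A : ι → ℝ} (hA : ∀ i ∈ s, 0 < A i) :
    IsUnit (∏ i ∈ s, betaMoments (A i)) :=
  (IsUnit.prod_iff).2 fun i hi => isUnit_betaMoments (hA i hi)

theorem integral_unitInterval_rpow {r : ℝ} (hr : -1 < r) :
    ∫ t : unitInterval, (t : ℝ) ^ r = 1 / (r + 1) := by
  have h := integral_subtype_comap (μ := volume) (measurableSet_Icc (a := (0 : ℝ)) (b := 1))
    fun t : ℝ => t ^ r
  refine h.trans ?_
  rw [integral_Icc_eq_integral_Ioc, ← intervalIntegral.integral_of_le zero_le_one,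
    integral_rpow (Or.inl hr), Real.one_rpow, Real.zero_rpow (by linarith), sub_zero]

theorem betaMoments_mem_momentSequences {a : ℝ} (ha : 0 < a) :
    betaMoments a ∈ momentSequences := by
  -- If `U` is uniform on `[0, 1]`, then `U ^ a⁻¹` has the distribution Beta(`a`, 1).
  let root (t : unitInterval) : unitInterval := ⟨(t : ℝ) ^ a⁻¹, Real.rpow_nonneg t.2.1 _,
    Real.rpow_le_one t.2.1 t.2.2 (by positivity)⟩
  have hroot : Measurable root := (measurable_subtype_coe.pow_const _).subtype_mk
  refine ⟨⟨volume.map root, Measure.isProbabilityMeasure_map hroot.aemeasurable⟩, ?_⟩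
  ext n
  have hpow (t : unitInterval) : (root t : ℝ) ^ n = (t : ℝ) ^ (a⁻¹ * n) :=
    (Real.rpow_mul_natCast t.2.1 a⁻¹ n).symm
  have hexp : -1 < a⁻¹ * n := by linarith [show 0 ≤ a⁻¹ * n by positivity]
  simp only [ProbabilityMeasure.coe_mk, moments_map hroot, hpow, integral_unitInterval_rpow hexp,
    betaMoments]
  field_simp
  ring

theorem betaMoments_div_mem_momentSequences {a b : ℝ} (ha : 0 < a) (hab : a ≤ b) :
    betaMoments a / betaMoments b ∈ momentSequences := by
  have hb : 0 < b := ha.trans_le hab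
  convert smul_one_add_smul_mem_momentSequences (betaMoments_mem_momentSequences ha)
    (c := a / b) (by positivity) ((div_le_one hb).2 hab) using 1
  ext n
  simp only [betaMoments, Pi.div_apply, Pi.add_apply, Pi.smul_apply, Pi.one_apply, smul_eq_mul]
  field_simp
  ring

theorem betaMoments_mul_div_mul_mem_momentSequences {x y z w : ℝ} (hx : 0 < x) (hxz : x ≤ z)
    (hzy : z ≤ y) (hsum : x + y = z + w) :
    betaMoments x * betaMoments y / (betaMoments z * betaMoments w) ∈ momentSequences := by
  have hz : 0 < z := hx.trans_le hxz
  have hy : 0 < y := hz.trans_le hzy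
  have hw : 0 < w := by linarith
  have hprod : x * y ≤ z * w := by
    obtain rfl : w = x + y - z := by linarith
    nlinarith [mul_nonneg (sub_nonneg.2 hxz) (sub_nonneg.2 hzy)]
  convert smul_one_add_smul_mem_momentSequences
    (mul_mem (betaMoments_mem_momentSequences hx) (betaMoments_mem_momentSequences hy))
    (c := x * y / (z * w)) (by positivity) ((div_le_one (by positivity)).2 hprod) using 1
  ext n
  simp only [betaMoments, Pi.div_apply, Pi.mul_apply, Pi.add_apply, Pi.smul_apply, Pi.one_apply,
    smul_eq_mul]
  obtain rfl : y = z + w - x := by linarith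
  field_simp
  ring

theorem head_le_of_sum_Iic_le {M : Type*} [AddCommMonoid M] [LE M] {q : ℕ}
    {A B : Fin (q + 1) → M} (hsum : ∀ k, ∑ i ∈ Iic k, A i ≤ ∑ i ∈ Iic k, B i) : A 0 ≤ B 0 := by
  have hIic : Iic (0 : Fin (q + 1)) = {0} := Iic_bot
  simpa only [hIic, sum_singleton] using hsum 0

theorem pos_of_sum_Iic_le {M : Type*} [AddCommMonoid M] [Preorder M] {q : ℕ} {A B : Fin q → M}
    (hA : ∀ i, 0 < A i) (hB : Monotone B)
    (hsum : ∀ k, ∑ i ∈ Iic k, A i ≤ ∑ i ∈ Iic k, B i) (i : Fin q) : 0 < B i := by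
  cases q with
  | zero => exact i.elim0
  | succ q => exact (hA 0).trans_le ((head_le_of_sum_Iic_le hsum).trans (hB (Fin.zero_le i)))

theorem sum_Iic_succ {M : Type*} [AddCommMonoid M] {q : ℕ} (C : Fin (q + 1) → M) (k : Fin q) :
    ∑ i ∈ Iic k.succ, C i = C 0 + ∑ i ∈ Iic k, C i.succ := by
  have hIic : Iic k.succ = insert 0 ((Iic k).map (Fin.succEmb q)) := by
    ext i
    refine Fin.cases ?_ (fun i => ?_) i <;> simp
  rw [hIic, sum_insert (by simp), sum_map]
  rfl

theorem sum_Iic_update_le {M : Type*} [AddCommGroup M] [PartialOrder M] [IsOrderedAddMonoid M]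
    {q : ℕ} {A B : Fin (q + 1) → M} (hB : Monotone B)
    (hsum : ∀ k, ∑ i ∈ Iic k, A i ≤ ∑ i ∈ Iic k, B i) {j : Fin q}
    (hj : ∀ i < j, A i.succ ≤ B 0) (k : Fin q) :
    ∑ i ∈ Iic k, Function.update (fun i => A i.succ) j (A 0 + A j.succ - B 0) i ≤
      ∑ i ∈ Iic k, B i.succ := by
  rcases le_or_gt j k with hjk | hkj
  · have hk := hsum k.succ
    rw [sum_Iic_succ, sum_Iic_succ,
      sum_eq_add_sum_sdiff_singleton_of_mem (mem_Iic.2 hjk) fun i => A i.succ] at hk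
    rw [sum_update_of_mem (mem_Iic.2 hjk), sub_add_eq_add_sub, add_assoc]
    exact sub_left_le_of_le_add hk
  · refine sum_le_sum fun i hi => ?_
    have hij : i < j := (mem_Iic.1 hi).trans_lt hkj
    rw [Function.update_of_ne hij.ne]
    exact (hj i hij).trans (hB (Fin.zero_le _))

theorem prod_betaMoments_div_update_mem_momentSequences {q : ℕ} {A : Fin (q + 1) → ℝ}
    (hA : ∀ i, 0 < A i) {b : ℝ} {j : Fin q} (h0 : A 0 ≤ b) (hj : b ≤ A j.succ) :
    (∏ i, betaMoments (A i)) / (betaMoments b * ∏ i, betaMoments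
      (Function.update (fun i => A i.succ) j (A 0 + A j.succ - b) i)) ∈ momentSequences := by
  have hrest : IsUnit (∏ i ∈ univ \ {j}, betaMoments (A i.succ)) :=
    isUnit_prod_betaMoments fun i _ => hA i.succ
  have hupdate (i : Fin q) : betaMoments
      (Function.update (fun i => A i.succ) j (A 0 + A j.succ - b) i) = Function.update
        (fun i => betaMoments (A i.succ)) j (betaMoments (A 0 + A j.succ - b)) i :=
    Function.apply_update (fun _ => betaMoments) _ j _ i
  rw [Fin.prod_univ_succ, prod_eq_mul_prod_sdiff_singleton_of_mem (mem_univ j)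
    fun i : Fin q => betaMoments (A i.succ), prod_congr rfl fun i _ => hupdate i,
    prod_update_of_mem (mem_univ j), ← mul_assoc, ← mul_assoc, hrest.mul_div_mul_right]
  exact betaMoments_mul_div_mul_mem_momentSequences (hA 0) h0 hj (by ring)

theorem exists_prod_betaMoments_div_mem_momentSequences {q : ℕ} {A B : Fin (q + 1) → ℝ}
    (hA : ∀ i, 0 < A i) (hB : Monotone B)
    (hsum : ∀ k, ∑ i ∈ Iic k, A i ≤ ∑ i ∈ Iic k, B i) :
    ∃ A' : Fin q → ℝ, (∀ i, 0 < A' i) ∧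
      (∀ k, ∑ i ∈ Iic k, A' i ≤ ∑ i ∈ Iic k, B i.succ) ∧
      (∏ i, betaMoments (A i)) / (betaMoments (B 0) * ∏ i, betaMoments (A' i)) ∈
        momentSequences := by
  have h0 : A 0 ≤ B 0 := head_le_of_sum_Iic_le hsum
  by_cases hlarge : ∃ j : Fin q, B 0 < A j.succ
  · -- Lower the first entry above `B 0`: the entries before it are at most `B 0`, so the partial
    -- sums that do not see the change are dominated termwise.
    obtain ⟨j, hj⟩ := exists_minimal_of_wellFoundedLT _ hlarge
    refine ⟨Function.update (fun i => A i.succ) j (A 0 + A j.succ - B 0), fun i => ?_,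
      sum_Iic_update_le hB hsum fun i hi => not_lt.1 (hj.not_prop_of_lt hi),
      prod_betaMoments_div_update_mem_momentSequences hA h0 hj.prop.le⟩
    rw [Function.update_apply]
    split_ifs
    · linarith [hA 0, hj.prop]
    · exact hA i.succ
  · push Not at hlarge
    refine ⟨fun i => A i.succ, fun i => hA i.succ,
      fun k => sum_le_sum fun i _ => (hlarge i).trans (hB (Fin.zero_le _)), ?_⟩
    rw [Fin.prod_univ_succ,
      (isUnit_prod_betaMoments fun i _ => hA i.succ).mul_div_mul_right]
    exact betaMoments_div_mem_momentSequences (hA 0) h0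

theorem prod_betaMoments_div_mem_momentSequences {q : ℕ} {A B : Fin q → ℝ} (hA : ∀ i, 0 < A i)
    (hB : Monotone B) (hsum : ∀ k, ∑ i ∈ Iic k, A i ≤ ∑ i ∈ Iic k, B i) :
    (∏ i, betaMoments (A i)) / ∏ i, betaMoments (B i) ∈ momentSequences := by
  induction q with
  | zero => simp
  | succ q ih =>
    obtain ⟨A', hA', hsum', hmem⟩ :=
      exists_prod_betaMoments_div_mem_momentSequences hA hB hsum
    have htail := ih hA' (hB.comp (Fin.strictMono_succ).monotone) hsum'
    have hunit : IsUnit (∏ i, betaMoments (A' i)) := isUnit_prod_betaMoments fun i _ => hA' i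
    convert mul_mem hmem htail using 1
    rw [Fin.prod_univ_succ fun i => betaMoments (B i), ← div_div, ← div_div]
    simp only [Function.comp_apply]
    rw [div_mul_div_comm, mul_comm (∏ i, betaMoments (A' i)), hunit.mul_div_mul_right, div_div]

theorem prod_range_betaMoments_add {a : ℝ} (ha : 0 < a) (n K : ℕ) :
    ∏ k ∈ range K, betaMoments (a + k) n =
      (ascPochhammer ℝ n).eval a / (ascPochhammer ℝ n).eval (a + K) := by
  have hshift (c : ℝ) : c * (ascPochhammer ℝ n).eval (c + 1) =
      (ascPochhammer ℝ n).eval c * (c + n) := by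
    rw [← ascPochhammer_succ_eval, ascPochhammer_succ_left]
    simp
  have hpos (k : ℕ) : 0 < (ascPochhammer ℝ n).eval (a + k) :=
    ascPochhammer_pos n _ (by positivity)
  induction K with
  | zero => simpa using (div_self (ascPochhammer_pos n a ha).ne').symm
  | succ K ih =>
    have hK := hpos K
    have hK1 := hpos (K + 1)
    push_cast [← add_assoc] at hK1
    rw [prod_range_succ, ih, betaMoments, div_mul_div_comm, Nat.cast_succ, ← add_assoc,
      div_eq_div_iff (by positivity) hK1.ne']
    linear_combination (ascPochhammer ℝ n).eval a * hshift (a + K)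

theorem tendsto_ascPochhammer_eval_add_div (a b : ℝ) (n : ℕ) :
    Tendsto (fun K : ℕ => (ascPochhammer ℝ n).eval (b + K) / (ascPochhammer ℝ n).eval (a + K))
      atTop (𝓝 1) := by
  induction n with
  | zero => simp
  | succ n ih =>
    have h := ih.mul (tendsto_add_mul_div_add_mul_atTop_nhds (b + n) (a + n) (1 : ℝ) one_ne_zero)
    simp only [div_one, mul_one] at h
    refine h.congr fun K => ?_
    rw [ascPochhammer_succ_eval, ascPochhammer_succ_eval, mul_div_mul_comm]
    congr 2 <;> ring

theorem prod_ascPochhammer_div_mem_momentSequences {q : ℕ} {A B : Fin q → ℝ}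
    (hA : ∀ i, 0 < A i) (hB : Monotone B)
    (hsum : ∀ k, ∑ i ∈ Iic k, A i ≤ ∑ i ∈ Iic k, B i) :
    (fun n => ∏ i, (ascPochhammer ℝ n).eval (A i) / (ascPochhammer ℝ n).eval (B i)) ∈
      momentSequences := by
  have hmem (K : ℕ) : ∏ k ∈ range K,
      ((∏ i, betaMoments (A i + k)) / ∏ i, betaMoments (B i + k)) ∈ momentSequences :=
    prod_mem fun k _ => prod_betaMoments_div_mem_momentSequences
      (fun i => add_pos_of_pos_of_nonneg (hA i) k.cast_nonneg) (hB.add_const _) fun j => by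
        simpa only [sum_add_distrib, add_le_add_iff_right] using hsum j
  refine isClosed_momentSequences.mem_of_tendsto (b := atTop) (tendsto_pi_nhds.2 fun n => ?_)
    (Eventually.of_forall hmem)
  have hprod (K : ℕ) : (∏ k ∈ range K,
      ((∏ i, betaMoments (A i + k)) / ∏ i, betaMoments (B i + k))) n =
      ∏ i, (ascPochhammer ℝ n).eval (A i) / (ascPochhammer ℝ n).eval (B i) *
        ((ascPochhammer ℝ n).eval (B i + K) / (ascPochhammer ℝ n).eval (A i + K)) := by
    simp only [Finset.prod_apply, Pi.div_apply, ← prod_div_distrib]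
    rw [Finset.prod_comm]
    refine prod_congr rfl fun i _ => ?_
    rw [prod_div_distrib, prod_range_betaMoments_add (hA i),
      prod_range_betaMoments_add (pos_of_sum_Iic_le hA hB hsum i), div_div_div_eq,
      div_mul_div_comm, mul_comm (Polynomial.eval (A i + K) _)]
  simp only [hprod]
  refine tendsto_finsetProd _ fun i _ => ?_
  simpa only [mul_one] using (tendsto_ascPochhammer_eval_add_div (A i) (B i) n).const_mul _

theorem one_sub_mul_mem_slitPlane {z : ℂ} (hz : z ∈ cutPlane) (t : unitInterval) :
    1 - (t : ℂ) * z ∈ Complex.slitPlane := by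
  have hz' : 1 + -z ∈ Complex.slitPlane := by
    simpa [← sub_eq_add_neg, Complex.mem_slitPlane_iff, cutPlane] using hz
  simpa [← sub_eq_add_neg] using
    Complex.starConvex_one_slitPlane.add_smul_mem hz' t.2.1 t.2.2

theorem one_sub_mul_pos {x : ℝ} (hx : x < 1) (t : unitInterval) : 0 < 1 - (t : ℝ) * x := by
  rcases le_total x 0 with h | h
  · nlinarith [t.2.1]
  · nlinarith [t.2.2]

theorem ascPochhammer_eval_ofReal (σ : ℝ) (n : ℕ) :
    (ascPochhammer ℂ n).eval (σ : ℂ) = ((ascPochhammer ℝ n).eval σ : ℝ) := by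
  rw [← ascPochhammer_map Complex.ofRealHom, Polynomial.eval_map, ← Complex.ofRealHom_eq_coe,
    Polynomial.eval₂_at_apply, Complex.ofRealHom_eq_coe]

theorem hasSum_one_sub_cpow_neg (σ : ℂ) {w : ℂ} (hw : ‖w‖ < 1) :
    HasSum (fun n : ℕ => (ascPochhammer ℂ n).eval σ / n.factorial * w ^ n) ((1 - w) ^ (-σ)) := by
  have h := (Complex.one_div_one_sub_cpow_hasFPowerSeriesOnBall_zero σ).hasSum (y := w)
    (by simpa [← ofReal_norm] using hw)
  have hchoose (n : ℕ) :
      Ring.choose (σ + n - 1) n = (ascPochhammer ℂ n).eval σ / n.factorial := by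
    rw [eq_div_iff (Nat.cast_ne_zero.2 n.factorial_ne_zero), mul_comm, ← nsmul_eq_mul,
      ← Polynomial.ascPochhammer_smeval_eq_eval,
      ← Ring.factorial_nsmul_multichoose_eq_ascPochhammer, Ring.choose]
    congr 2
    ring
  simpa only [FormalMultilinearSeries.ofScalars_apply_eq, zero_add, smul_eq_mul, hchoose, one_div,
    ← Complex.cpow_neg] using h

theorem hasSum_moments_mul_pow (μ : Measure unitInterval) [IsFiniteMeasure μ] {c : ℕ → ℂ}
    {f : ℂ → ℂ} (hf : ∀ w, ‖w‖ < 1 → HasSum (fun n => c n * w ^ n) (f w)) {z : ℂ} (hz : ‖z‖ < 1) :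
    HasSum (fun n => c n * moments μ n * z ^ n) (∫ t : unitInterval, f (t * z) ∂μ) := by
  have hnorm (t : unitInterval) : ‖(t : ℂ) * z‖ ≤ ‖z‖ := by
    rw [norm_mul, Complex.norm_real, Real.norm_of_nonneg t.2.1]
    exact mul_le_of_le_one_left (norm_nonneg z) t.2.2
  have hterm (n : ℕ) :
      ∫ t : unitInterval, c n * ((t : ℂ) * z) ^ n ∂μ = c n * moments μ n * z ^ n := by
    simp only [moments, mul_pow, ← mul_assoc, ← integral_complex_ofReal, integral_mul_const,
      integral_const_mul, Complex.ofReal_pow]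
  simp only [← hterm]
  refine hasSum_integral_of_dominated_convergence (fun n _ => ‖c n * z ^ n‖)
    (fun n => by fun_prop) (fun n => Eventually.of_forall fun t => ?_)
    (Eventually.of_forall fun _ => (hf z hz).summable.norm) (integrable_const _)
    (Eventually.of_forall fun t => hf _ ((hnorm t).trans_lt hz))
  simp only [norm_mul (c n), norm_pow]
  gcongr
  exact hnorm t

theorem differentiableOn_integral {𝕜 X E : Type*} [RCLike 𝕜] [TopologicalSpace X] [CompactSpace X]
    [MeasurableSpace X] [OpensMeasurableSpace X] [NormedAddCommGroup E] [NormedSpace ℝ E]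
    [NormedSpace 𝕜 E] [SecondCountableTopologyEither X E] (μ : Measure X) [IsFiniteMeasure μ]
    {U : Set 𝕜} (hU : IsOpen U) {F F' : 𝕜 → X → E} (hF : ∀ z ∈ U, Continuous (F z))
    (hF' : ContinuousOn (Function.uncurry F') (U ×ˢ Set.univ))
    (hderiv : ∀ z ∈ U, ∀ x, HasDerivAt (F · x) (F' z x) z) :
    DifferentiableOn 𝕜 (fun z => ∫ x, F z x ∂μ) U := by
  intro z₀ hz₀
  obtain ⟨K, hK, hz₀K, hKU⟩ := exists_compact_subset hU hz₀
  obtain ⟨C, hC⟩ := (hK.prod isCompact_univ).exists_bound_of_continuousOn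
    (hF'.mono (Set.prod_mono_left hKU))
  have hF'z₀ : Continuous (F' z₀) := hF'.comp_continuous
    (f := fun x => (z₀, x)) (by fun_prop) fun x => ⟨hz₀, Set.mem_univ x⟩
  have h := hasDerivAt_integral_of_dominated_loc_of_deriv_le (μ := μ) (bound := fun _ => C)
    (mem_interior_iff_mem_nhds.1 hz₀K)
    (by filter_upwards [hU.mem_nhds hz₀] with z hz using (hF z hz).aestronglyMeasurable)
    (integrable_of_continuous (hF z₀ hz₀)) hF'z₀.aestronglyMeasurable
    (Eventually.of_forall fun x z hz => hC (z, x) ⟨hz, Set.mem_univ x⟩) (integrable_const C)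
    (Eventually.of_forall fun x z hz => hderiv z (hKU hz) x)
  exact h.2.differentiableAt.differentiableWithinAt

/-- The generalized Stieltjes transform of order `σ`, normalized so as to be holomorphic on
`ℂ \ [1, ∞)` with Taylor coefficients `(σ)_n / n!` times the moments of `μ`. -/
noncomputable def stieltjes (μ : Measure unitInterval) (σ z : ℂ) : ℂ :=
  ∫ t : unitInterval, (1 - (t : ℂ) * z) ^ (-σ) ∂μ

theorem differentiableOn_stieltjes (μ : Measure unitInterval) [IsFiniteMeasure μ] (σ : ℂ) :
    DifferentiableOn ℂ (stieltjes μ σ) cutPlane := by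
  refine differentiableOn_integral μ isOpen_cutPlane
    (F' := fun z t => -σ * (1 - (t : ℂ) * z) ^ (-σ - 1) * (-t)) (fun z hz => ?_) ?_
    fun z hz t => ?_
  · exact Continuous.cpow (by fun_prop) continuous_const (one_sub_mul_mem_slitPlane hz)
  · exact (continuousOn_const.mul (ContinuousOn.cpow (by fun_prop) continuousOn_const
      fun p hp => one_sub_mul_mem_slitPlane hp.1 p.2)).mul (by fun_prop)
  · have h : HasDerivAt (fun z : ℂ => 1 - (t : ℂ) * z) (-t) z := by
      simpa using ((hasDerivAt_id z).const_mul (t : ℂ)).const_sub 1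
    exact h.cpow_const (one_sub_mul_mem_slitPlane hz t)

theorem isExtension_stieltjes {q : ℕ} (σ : ℝ) {A B : Fin q → ℝ} {μ : Measure unitInterval}
    [IsFiniteMeasure μ] (hμ : moments μ =
      fun n => ∏ i, (ascPochhammer ℝ n).eval (A i) / (ascPochhammer ℝ n).eval (B i)) :
    IsExtension σ A B (stieltjes μ σ) := by
  refine ⟨differentiableOn_stieltjes μ σ, fun z hz => ?_⟩
  have hcoeff (n : ℕ) : (coeff σ A B n : ℂ) =
      (ascPochhammer ℂ n).eval (σ : ℂ) / n.factorial * moments μ n := by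
    simp only [hμ, coeff, ascPochhammer_eval_ofReal, prod_div_distrib]
    push_cast
    rw [div_mul_div_comm, mul_comm (n.factorial : ℂ)]
  simp only [hcoeff]
  exact hasSum_moments_mul_pow μ (fun w hw => hasSum_one_sub_cpow_neg σ hw) hz

section Mgf

variable {Ω : Type*} [MeasurableSpace Ω] {μ : Measure Ω} {X : Ω → ℝ}

theorem mgf_add_le_rpow_mul_rpow {s t a b : ℝ} (hs : s ∈ integrableExpSet X μ)
    (ht : t ∈ integrableExpSet X μ) (ha : 0 < a) (hb : 0 < b) (hab : a + b = 1) :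
    mgf X μ (a * s + b * t) ≤ mgf X μ s ^ a * mgf X μ t ^ b := by
  have hroot (c r : ℝ) (ω : Ω) : Real.exp (r * X ω) ^ c = Real.exp (c * r * X ω) := by
    rw [← Real.exp_mul]
    ring_nf
  have hpow {c : ℝ} (hc : 0 < c) (r : ℝ) (ω : Ω) :
      Real.exp (c * r * X ω) ^ (1 / c) = Real.exp (r * X ω) := by
    rw [hroot, ← mul_assoc, one_div_mul_cancel hc.ne', one_mul]
  have hmem {c r : ℝ} (hc : 0 < c) (hr : r ∈ integrableExpSet X μ) :
      MemLp (fun ω => Real.exp (c * r * X ω)) (ENNReal.ofReal (1 / c)) μ := by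
    have hmeas : AEStronglyMeasurable (fun ω => Real.exp (c * r * X ω)) μ := by
      simpa only [hroot] using (hr.aemeasurable.pow_const c).aestronglyMeasurable
    rw [← integrable_norm_rpow_iff hmeas (by simpa using hc) ENNReal.ofReal_ne_top]
    simpa only [Real.norm_eq_abs, Real.abs_exp, ENNReal.toReal_ofReal (one_div_pos.2 hc).le,
      hpow hc] using show Integrable (fun ω => Real.exp (r * X ω)) μ from hr
  have h := integral_mul_le_Lp_mul_Lq_of_nonneg (Real.holderConjugate_one_div ha hb hab)
    (Eventually.of_forall fun ω => (Real.exp_pos (a * s * X ω)).le)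
    (Eventually.of_forall fun ω => (Real.exp_pos (b * t * X ω)).le) (hmem ha hs) (hmem hb ht)
  simpa only [mgf, add_mul, Real.exp_add, hpow ha, hpow hb, one_div_one_div] using h

theorem convexOn_cgf : ConvexOn ℝ (integrableExpSet X μ) (cgf X μ) := by
  rcases eq_or_ne μ 0 with rfl | hμ
  · rw [cgf_zero_measure]
    exact convexOn_const 0 convex_integrableExpSet
  refine convexOn_iff_forall_pos.2 ⟨convex_integrableExpSet, fun s hs t ht a b ha hb hab => ?_⟩
  have hpos {r : ℝ} (hr : r ∈ integrableExpSet X μ) : 0 < mgf X μ r := mgf_pos' hμ hr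
  have hmem := convex_integrableExpSet hs ht ha.le hb.le hab
  simp only [cgf, smul_eq_mul] at hmem ⊢
  rw [← Real.log_rpow (hpos hs), ← Real.log_rpow (hpos ht), ← Real.log_mul
    (Real.rpow_pos_of_pos (hpos hs) a).ne' (Real.rpow_pos_of_pos (hpos ht) b).ne']
  exact Real.log_le_log (hpos hmem) (mgf_add_le_rpow_mul_rpow hs ht ha hb hab)

theorem logConvexOn_mgf [NeZero μ] : LogConvexOn (integrableExpSet X μ) (mgf X μ) :=
  ⟨fun _ ht => mgf_pos' (NeZero.ne μ) ht, convexOn_cgf⟩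

end Mgf

theorem integrableExpSet_eq_univ_of_continuous {Ω : Type*} [TopologicalSpace Ω] [CompactSpace Ω]
    [MeasurableSpace Ω] [OpensMeasurableSpace Ω] {X : Ω → ℝ} (hX : Continuous X) (μ : Measure Ω)
    [IsFiniteMeasureOnCompacts μ] : integrableExpSet X μ = Set.univ :=
  Set.eq_univ_of_forall fun _ => integrable_of_continuous (by fun_prop)

theorem stieltjes_ofReal_eq_mgf (μ : Measure unitInterval) (σ : ℝ) {x : ℝ} (hx : x < 1) :
    stieltjes μ σ x = mgf (fun t : unitInterval => -Real.log (1 - t * x)) μ σ := by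
  rw [mgf, ← integral_complex_ofReal, stieltjes]
  congr 1 with t
  have hpos := one_sub_mul_pos hx t
  rw [mul_neg, ← neg_mul, mul_comm (-σ), ← Real.rpow_def_of_pos hpos, Complex.ofReal_cpow hpos.le]
  push_cast
  rfl

theorem logConvexOn_mgf_neg_log_one_sub_mul (μ : Measure unitInterval) [IsFiniteMeasure μ]
    [NeZero μ] {x : ℝ} (hx : x < 1) :
    LogConvexOn Set.univ (mgf (fun t : unitInterval => -Real.log (1 - t * x)) μ) := by
  have hcont : Continuous fun t : unitInterval => -Real.log (1 - t * x) :=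
    (Continuous.log (by fun_prop) fun t => (one_sub_mul_pos hx t).ne').neg
  rw [← integrableExpSet_eq_univ_of_continuous hcont μ]
  exact logConvexOn_mgf

theorem LogConvexOn.subset {s t : Set ℝ} {f : ℝ → ℝ} (hf : LogConvexOn t f) (hst : s ⊆ t)
    (hs : Convex ℝ s) : LogConvexOn s f :=
  ⟨fun r hr => hf.1 r (hst hr), hf.2.subset hst hs⟩

end GenHyp

theorem mainTheorem3_general {q : ℕ} (A B : Fin q → ℝ) (hA : ∀ i, 0 < A i) (hB : Monotone B)
    (hsum : ∀ k, ∑ i ∈ Finset.Iic k, A i ≤ ∑ i ∈ Finset.Iic k, B i) :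
    (∀ σ : ℝ, GenHyp.IsExtension σ A B (GenHyp.hyp σ A B)) ∧
    ∀ x : ℝ, x < 1 →
      (∀ σ : ℝ, (GenHyp.hyp σ A B (x : ℂ)).im = 0) ∧
      GenHyp.LogConvexOn Set.univ (fun σ : ℝ => (GenHyp.hyp σ A B (x : ℂ)).re) := by
  obtain ⟨μ, hμ⟩ := GenHyp.prod_ascPochhammer_div_mem_momentSequences hA hB hsum
  have hstieltjes (σ : ℝ) := GenHyp.isExtension_stieltjes σ hμ
  have hhyp (σ : ℝ) := GenHyp.isExtension_hyp (hstieltjes σ)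
  refine ⟨hhyp, fun x hx => ?_⟩
  have hval (σ : ℝ) : GenHyp.hyp σ A B x = _ :=
    ((hhyp σ).eqOn (hstieltjes σ) (Or.inl hx)).trans (GenHyp.stieltjes_ofReal_eq_mgf _ σ hx)
  simp only [hval, Complex.ofReal_im, Complex.ofReal_re, implies_true, true_and]
  exact GenHyp.logConvexOn_mgf_neg_log_one_sub_mul _ hx

theorem mainTheorem3 {q : ℕ} (A B : Fin q → ℝ) (hBA : GenHyp.WeaklySupermajorizedBy B A) :
    (∀ σ : ℝ, 0 ≤ σ → GenHyp.IsExtension σ A B (GenHyp.hyp σ A B)) ∧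
    ∀ x : ℝ, x < 1 →
      (∀ σ : ℝ, 0 ≤ σ → (GenHyp.hyp σ A B (x : ℂ)).im = 0) ∧
      GenHyp.LogConvexOn (Set.Ici 0) (fun σ : ℝ => (GenHyp.hyp σ A B (x : ℂ)).re) := by
  obtain ⟨hext, hreal⟩ := mainTheorem3_general A B hBA.pos_right hBA.mono_left hBA.sum_le
  exact ⟨fun σ _ => hext σ, fun x hx => ⟨fun σ _ => (hreal x hx).1 σ,
    (hreal x hx).2.subset (Set.subset_univ _) (convex_Ici 0)⟩⟩
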